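/- Let $p>1$ and $T\in\mathbb R$. For $t\in(-\infty,T)$ let $K_t\subset\mathbb R^2$ be convex bodies whose interiors contain the origin, and let $X:\mathbb S^1\times(-\infty,T)\to\mathbb R^2$ be a smooth map such that, for every $t<T$, $X(\cdot,t)$ is a counterclockwise smooth embedding of $\mathbb S^1=\mathbb R/2\pi\mathbb Z$ with image $\partial K_t$ and positive curvature (so that $K_t$ is smooth and strictly convex). For a curve $\gamma=X(\cdot,t)$ with parameter $u$, write $[v,w]$ for the determinant with rows $v,w$, put $\mathfrak g=[\gamma_u,\gamma_{uu}]^{1/3}$, let $\mathfrak s(u)=\int_0^u\mathfrak g$ be the affine arc length, so that $\partial_{\mathfrak s}=\mathfrak g^{-1}\partial_u$, and let $\mathfrak n=\gamma_{\mathfrak s\mathfrak s}$ be the affine normal. Let $s(z)=\max_{x\in K_t}\langle x,z\rangle$ be the support function of $K_t$, let $\mathfrak r=\partial_\theta^2 s+s$, as a function of $z=(\cos\theta,\sin\theta)\in\mathbb S^1$, be its radius of curvature, let $\nu$ be the outward unit normal of $\partial K_t$, and let $\sigma=s(\nu)\,\mathfrak r(\nu)^{1/3}$ be the affine support function. Suppose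 that $X$ is an ancient solution of the affine form of the $p$-flow, i.e. $$\partial_t X=\sigma^{1-\frac{3p}{p+2}}\,\mathfrak n\qquad\text{on }\mathbb S^1\times(-\infty,T).$$ Then $\sigma(u,t)=\sigma(X(u,t),t)$ is positive and is differentiable in $u$ and in $t$, and at every point of $\mathbb S^1\times(-\infty,T)$, with $\partial_t$ taken at fixed $u$, $$\partial_t\sigma\le-\left(\frac{3p}{p+2}-1\right)\sigma_{\mathfrak s}^2\,\sigma^{-\frac{3p}{p+2}} .$$ -/

import Mathlib

open scoped ContDiff

/-- The Euclidean plane. -/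
abbrev Plane : Type := EuclideanSpace ℝ (Fin 2)

/-- `[u, v]`: the determinant of the matrix with rows `u` and `v`. -/
noncomputable def bracket (u v : Plane) : ℝ := u 0 * v 1 - u 1 * v 0

/-- Counterclockwise rotation by a right angle. -/
noncomputable def rot90 (z : Plane) : Plane := !₂[-z 1, z 0]

/-- The support function `s_K(z) = max_{x ∈ K} ⟨x, z⟩` of a convex body. -/
noncomputable def supportFn (K : ConvexBody Plane) (z : Plane) : ℝ :=
  sSup ((fun x : Plane => inner ℝ x z) '' (K : Set Plane))

/-- The radius of curvature `𝔯 = ∂²s/∂θ² + s` at the unit vector `z`, where `∂/∂θ` is the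
derivative with respect to the angle on the unit circle: `φ ↦ cos φ • z + sin φ • rot90 z` is the
rotation of `z` by the angle `φ` (see `radiusOfCurvature_angle`). -/
noncomputable def radiusOfCurvature (K : ConvexBody Plane) (z : Plane) : ℝ :=
  iteratedDeriv 2 (fun φ : ℝ => supportFn K (Real.cos φ • z + Real.sin φ • rot90 z)) 0
    + supportFn K z

theorem radiusOfCurvature_angle (K : ConvexBody Plane) (θ : ℝ) :
    radiusOfCurvature K !₂[Real.cos θ, Real.sin θ] =
      iteratedDeriv 2 (fun φ : ℝ => supportFn K !₂[Real.cos φ, Real.sin φ]) θ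
        + supportFn K !₂[Real.cos θ, Real.sin θ] := by
  have h : (fun φ : ℝ => supportFn K (Real.cos φ • (!₂[Real.cos θ, Real.sin θ] : Plane)
      + Real.sin φ • rot90 !₂[Real.cos θ, Real.sin θ])) =
      fun φ : ℝ => (fun ψ : ℝ => supportFn K !₂[Real.cos ψ, Real.sin ψ]) (θ + φ) := by
    funext φ
    congr 1
    ext i
    fin_cases i <;> simp [rot90, Real.cos_add, Real.sin_add] <;> ring
  unfold radiusOfCurvature
  rw [h, iteratedDeriv_comp_const_add 2 (fun ψ : ℝ => supportFn K !₂[Real.cos ψ, Real.sin ψ]) θ]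
  simp

/-- The unit normal of the curve `γ` that points to the right of its direction of motion; for a
counterclockwise parametrization of the boundary of a convex body it is the outward unit normal. -/
noncomputable def unitNormal (γ : ℝ → Plane) (u : ℝ) : Plane :=
  -(‖deriv γ u‖⁻¹ • rot90 (deriv γ u))

/-- `γ` is a smooth, counterclockwise `2π`-periodic parametrization of the boundary of `K`,
embedded (one-to-one modulo `2π`) and of positive curvature. The condition `[γ_u, γ_uu] > 0` says
that `γ` is an immersion, that its curvature does not vanish, and that it runs counterclockwise. -/
structure ParametrizesBoundary (γ : ℝ → Plane) (K : ConvexBody Plane) : Prop where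
  smooth : ContDiff ℝ ∞ γ
  periodic : Function.Periodic γ (2 * Real.pi)
  injOn : Set.InjOn γ (Set.Ico 0 (2 * Real.pi))
  range_eq : Set.range γ = frontier (K : Set Plane)
  bracket_pos : ∀ u, 0 < bracket (deriv γ u) (iteratedDeriv 2 γ u)

/-- The density `𝔤 = [γ_u, γ_uu]^{1/3}` of affine arc length. -/
noncomputable def affineDensity (γ : ℝ → Plane) (u : ℝ) : ℝ :=
  bracket (deriv γ u) (iteratedDeriv 2 γ u) ^ (1 / 3 : ℝ)

/-- The affine arc length `𝔰(u) = ∫₀ᵘ 𝔤`. -/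
noncomputable def affineArcLength (γ : ℝ → Plane) (u : ℝ) : ℝ :=
  ∫ v in (0 : ℝ)..u, affineDensity γ v

/-- The derivative `f_𝔰 = 𝔤⁻¹ f_u` with respect to affine arc length along `γ` of a function `f` of
the curve parameter `u` (see `affineDeriv_comp_arcLength`). -/
noncomputable def affineDeriv {E : Type*} [NormedAddCommGroup E] [NormedSpace ℝ E]
    (γ : ℝ → Plane) (f : ℝ → E) (u : ℝ) : E :=
  (affineDensity γ u)⁻¹ • deriv f u

theorem affineDeriv_comp_arcLength {E : Type*} [NormedAddCommGroup E] [NormedSpace ℝ E]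
    {γ : ℝ → Plane} {K : ConvexBody Plane} (hγ : ParametrizesBoundary γ K) (h : ℝ → E) (u : ℝ)
    (hd : DifferentiableAt ℝ h (affineArcLength γ u)) :
    affineDeriv γ (fun v => h (affineArcLength γ v)) u = deriv h (affineArcLength γ u) := by
  have h1 : Continuous (deriv γ) := hγ.smooth.continuous_deriv (by norm_num)
  have h2 : Continuous (iteratedDeriv 2 γ) :=
    (contDiff_infty.1 hγ.smooth 2).continuous_iteratedDeriv 2 le_rfl
  have hc : Continuous (affineDensity γ) := by
    unfold affineDensity bracket
    refine Continuous.rpow_const ?_ (fun _ => Or.inr (by norm_num))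
    fun_prop
  have hs : HasDerivAt (affineArcLength γ) (affineDensity γ u) u :=
    intervalIntegral.integral_hasDerivAt_right (hc.intervalIntegrable _ _)
      (hc.stronglyMeasurableAtFilter _ _) hc.continuousAt
  have hpos : 0 < affineDensity γ u := Real.rpow_pos_of_pos (hγ.bracket_pos u) _
  have := (hd.hasDerivAt.scomp u hs).deriv
  unfold affineDeriv
  rw [show (fun v => h (affineArcLength γ v)) = h ∘ affineArcLength γ from rfl, this, smul_smul,
    inv_mul_cancel₀ hpos.ne', one_smul]

/-- The affine normal `𝔫 = γ_𝔰𝔰`. -/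
noncomputable def affineNormal (γ : ℝ → Plane) : ℝ → Plane :=
  affineDeriv γ (affineDeriv γ γ)

/-- The affine support function `σ = s(ν) 𝔯(ν)^{1/3}` of `K`, at the boundary point `γ u` with
outward unit normal `ν`. -/
noncomputable def affineSupport (K : ConvexBody Plane) (γ : ℝ → Plane) (u : ℝ) : ℝ :=
  supportFn K (unitNormal γ u) * radiusOfCurvature K (unitNormal γ u) ^ (1 / 3 : ℝ)

/-- `(K t, X t)`, `t ∈ (-∞, T)`, is an ancient solution of the affine form
`∂X/∂t = σ^{1 - 3p/(p+2)} 𝔫` of the `p`-flow: `X` is jointly smooth, and for each `t < T` the curve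
`X t` parametrizes the boundary of the smooth, strictly convex body `K t`, whose interior contains
the origin. -/
structure IsAncientSolution (p T : ℝ) (K : ℝ → ConvexBody Plane) (X : ℝ → ℝ → Plane) : Prop where
  smooth : ContDiffOn ℝ ∞ (fun q : ℝ × ℝ => X q.1 q.2) (Set.Iio T ×ˢ Set.univ)
  boundary : ∀ t < T, ParametrizesBoundary (X t) (K t)
  origin_mem : ∀ t < T, (0 : Plane) ∈ interior (K t : Set Plane)
  flow : ∀ t < T, ∀ u, HasDerivAt (fun τ => X τ u)
    (affineSupport (K t) (X t) u ^ (1 - 3 * p / (p + 2)) • affineNormal (X t) u) t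

/-!
Write `α = 3p/(p+2)`, so that `α > 1`, and let `𝔰` be the affine arc length of the evolving curve
`γ = X(·, t)`. The claimed inequality says that `σ` decreases in time when it is followed at a
fixed outward normal rather than at a fixed parameter `u`. This is a consequence of the Harnack
inequality for the flow, which for an ancient solution says that the normal speed `s σ ^ (-α)` at a
fixed normal is nondecreasing in time.

*Affine description of `σ`.* The tangent lines of a positively curved boundary curve support the
body (`ParametrizesBoundary.bracket_lt`), hence the support function and the radius of curvature at
the normal `ν` are `[γ, γ_u] / |γ_u|` and `|γ_u|³ / [γ_u, γ_uu]`
(`ParametrizesBoundary.supportFn_unitNormal`,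
`ParametrizesBoundary.radiusOfCurvature_unitNormal`). Thus `σ = [γ, γ_𝔰]`, which is smooth in
`(u, t)`, and it is positive since the origin is an interior point.

*Evolution equations.* From `[γ_𝔰, γ_𝔰𝔰] = 1` one gets `γ_𝔰𝔰𝔰 = -μ γ_𝔰` and `σ_𝔰𝔰 = 1 - μ σ`, and,
differentiating in time with the commutator `[∂_t, ∂_𝔰] = -(∂_t log 𝔤) ∂_𝔰`, the evolution of the
density `𝔤` and of `σ` (`SmoothFamily.evolution_of_normal_flow`). With `w = σ ^ (-α)`,
`f = σ ^ (1 - α)` and `l = (log σ)_𝔰`, everything becomes polynomial in `w`, `f`, `l` and the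
derivatives of `l`.

*Harnack quantity.* Let `q = (4α/3 - 1) w - (α²/3) f (l_𝔰 + (2 - α) l²)`; it is the logarithmic time
derivative of the normal speed at a fixed normal. A computation
(`SmoothFamily.evolution_of_harnack`) gives
`∂_t q = (α/3) f q_𝔰𝔰 + (1 + 2α/3) f_𝔰 q_𝔰 + q² + (α - 1) w² + (3/α) (q - (α - 1) w)²`,
so that `∂_t q > q²` at a spatial minimum. Comparison with the solutions `-1 / (t - t₀)` of
`y' = y²` gives `q ≥ -1 / (t - t₀)` for every `t₀ < t`, and `t₀ → -∞` yields `q ≥ 0`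
(`SmoothFamily.nonneg_of_ancient_supersolution`). Finally
`∂_t σ + (α - 1) σ_𝔰² σ ^ (-α) = -σ (q + w) / α ≤ 0`.
-/

/-! ### Partial derivatives of smooth families of functions -/

/-- The function `F` of time `t < T` and of the curve parameter `u` is jointly smooth. -/
def SmoothFamily (T : ℝ) (F : ℝ → ℝ → ℝ) : Prop :=
  ContDiffOn ℝ ∞ (fun q : ℝ × ℝ => F q.1 q.2) (Set.Iio T ×ˢ Set.univ)

/-- The partial derivative in the curve parameter. -/
noncomputable def paramDeriv (F : ℝ → ℝ → ℝ) (t u : ℝ) : ℝ := deriv (F t) u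

/-- The partial derivative in time, at a fixed curve parameter. -/
noncomputable def timeDeriv (F : ℝ → ℝ → ℝ) (t u : ℝ) : ℝ := deriv (fun τ => F τ u) t

namespace SmoothFamily

variable {T t : ℝ} {F G : ℝ → ℝ → ℝ}

theorem isOpen_slab (T : ℝ) : IsOpen (Set.Iio T ×ˢ (Set.univ : Set ℝ)) :=
  isOpen_Iio.prod isOpen_univ

theorem contDiffAt (hF : SmoothFamily T F) (ht : t < T) (u : ℝ) :
    ContDiffAt ℝ ∞ (fun q : ℝ × ℝ => F q.1 q.2) (t, u) :=
  ContDiffOn.contDiffAt hF ((isOpen_slab T).mem_nhds ⟨ht, trivial⟩)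

theorem hasFDerivAt (hF : SmoothFamily T F) (ht : t < T) (u : ℝ) :
    HasFDerivAt (fun q : ℝ × ℝ => F q.1 q.2)
      (fderiv ℝ (fun q : ℝ × ℝ => F q.1 q.2) (t, u)) (t, u) :=
  ((hF.contDiffAt ht u).differentiableAt (by simp)).hasFDerivAt

theorem hasDerivAt_param_fderiv (hF : SmoothFamily T F) (ht : t < T) (u : ℝ) :
    HasDerivAt (F t) (fderiv ℝ (fun q : ℝ × ℝ => F q.1 q.2) (t, u) (0, 1)) u :=
  (hF.hasFDerivAt ht u).comp_hasDerivAt (f := fun v : ℝ => (t, v)) u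
    ((hasDerivAt_const u t).prodMk (hasDerivAt_id u))

theorem hasDerivAt_time_fderiv (hF : SmoothFamily T F) (ht : t < T) (u : ℝ) :
    HasDerivAt (fun τ => F τ u) (fderiv ℝ (fun q : ℝ × ℝ => F q.1 q.2) (t, u) (1, 0)) t :=
  (hF.hasFDerivAt ht u).comp_hasDerivAt (f := fun τ : ℝ => (τ, u)) t
    ((hasDerivAt_id t).prodMk (hasDerivAt_const t u))

theorem hasDerivAt_param (hF : SmoothFamily T F) (ht : t < T) (u : ℝ) :
    HasDerivAt (F t) (paramDeriv F t u) u :=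
  (hF.hasDerivAt_param_fderiv ht u).differentiableAt.hasDerivAt

theorem hasDerivAt_time (hF : SmoothFamily T F) (ht : t < T) (u : ℝ) :
    HasDerivAt (fun τ => F τ u) (timeDeriv F t u) t :=
  (hF.hasDerivAt_time_fderiv ht u).differentiableAt.hasDerivAt

theorem paramDeriv_eq (hF : SmoothFamily T F) (ht : t < T) (u : ℝ) :
    paramDeriv F t u = fderiv ℝ (fun q : ℝ × ℝ => F q.1 q.2) (t, u) (0, 1) :=
  (hF.hasDerivAt_param_fderiv ht u).deriv

theorem timeDeriv_eq (hF : SmoothFamily T F) (ht : t < T) (u : ℝ) :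
    timeDeriv F t u = fderiv ℝ (fun q : ℝ × ℝ => F q.1 q.2) (t, u) (1, 0) :=
  (hF.hasDerivAt_time_fderiv ht u).deriv

theorem smooth_fderiv (hF : SmoothFamily T F) :
    ContDiffOn ℝ ∞ (fderiv ℝ (fun q : ℝ × ℝ => F q.1 q.2)) (Set.Iio T ×ˢ Set.univ) :=
  ContDiffOn.fderiv_of_isOpen hF (isOpen_slab T) (by simp)

theorem param (hF : SmoothFamily T F) : SmoothFamily T (paramDeriv F) :=
  (hF.smooth_fderiv.clm_apply contDiffOn_const).congr
    fun q hq => hF.paramDeriv_eq hq.1 q.2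

theorem time (hF : SmoothFamily T F) : SmoothFamily T (timeDeriv F) :=
  (hF.smooth_fderiv.clm_apply contDiffOn_const).congr
    fun q hq => hF.timeDeriv_eq hq.1 q.2

theorem timeDeriv_paramDeriv (hF : SmoothFamily T F) (ht : t < T) (u : ℝ) :
    timeDeriv (paramDeriv F) t u = paramDeriv (timeDeriv F) t u := by
  have hmem : (Set.Iio T ×ˢ (Set.univ : Set ℝ)) ∈ nhds (t, u) :=
    (isOpen_slab T).mem_nhds ⟨ht, trivial⟩
  have hd := (hF.smooth_fderiv.contDiffAt hmem).differentiableAt (by simp)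
  have hd' := hd.hasFDerivAt
  have key : ∀ v : ℝ × ℝ, ∀ H : ℝ → ℝ → ℝ,
      (∀ t < T, ∀ u, H t u = fderiv ℝ (fun q : ℝ × ℝ => F q.1 q.2) (t, u) v) →
      fderiv ℝ (fun q : ℝ × ℝ => H q.1 q.2) (t, u) =
        (fderiv ℝ (fderiv ℝ (fun q : ℝ × ℝ => F q.1 q.2)) (t, u)).flip v := by
    intro v H hH
    have h1 : (fun q : ℝ × ℝ => H q.1 q.2) =ᶠ[nhds (t, u)]
        fun q => fderiv ℝ (fun q : ℝ × ℝ => F q.1 q.2) q v := by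
      filter_upwards [hmem] with q hq using hH q.1 hq.1 q.2
    rw [h1.fderiv_eq]
    refine ((ContinuousLinearMap.apply ℝ ℝ v).hasFDerivAt.comp (t, u) hd').fderiv.trans ?_
    ext <;> simp
  rw [hF.param.timeDeriv_eq ht, hF.time.paramDeriv_eq ht,
    key (0, 1) _ fun t ht u => hF.paramDeriv_eq ht u,
    key (1, 0) _ fun t ht u => hF.timeDeriv_eq ht u]
  exact ((hF.contDiffAt ht u).isSymmSndFDerivAt
    (by simpa using WithTop.coe_le_coe.2 (le_top : (2 : ℕ∞) ≤ ⊤))).eq _ _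

theorem mul (hF : SmoothFamily T F) (hG : SmoothFamily T G) :
    SmoothFamily T fun t u => F t u * G t u := ContDiffOn.mul hF hG

theorem add (hF : SmoothFamily T F) (hG : SmoothFamily T G) :
    SmoothFamily T fun t u => F t u + G t u := ContDiffOn.add hF hG

theorem pow (hF : SmoothFamily T F) (n : ℕ) : SmoothFamily T fun t u => F t u ^ n :=
  ContDiffOn.pow hF n

theorem sub (hF : SmoothFamily T F) (hG : SmoothFamily T G) :
    SmoothFamily T fun t u => F t u - G t u := ContDiffOn.sub hF hG

theorem const (c : ℝ) : SmoothFamily T fun _ _ => c := contDiffOn_const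

theorem inv (hF : SmoothFamily T F) (h0 : ∀ t < T, ∀ u, F t u ≠ 0) :
    SmoothFamily T fun t u => (F t u)⁻¹ :=
  ContDiffOn.inv hF fun q hq => h0 q.1 hq.1 q.2

theorem rpow (hF : SmoothFamily T F) (h0 : ∀ t < T, ∀ u, F t u ≠ 0) (c : ℝ) :
    SmoothFamily T fun t u => F t u ^ c :=
  ContDiffOn.rpow_const_of_ne hF fun q hq => h0 q.1 hq.1 q.2

theorem congr (hF : SmoothFamily T F) (h : ∀ t < T, ∀ u, G t u = F t u) : SmoothFamily T G :=
  ContDiffOn.congr hF fun q hq => h q.1 hq.1 q.2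

end SmoothFamily

/-! ### Convex bodies with a smooth, positively curved boundary -/

theorem inner_plane (x z : Plane) : inner ℝ x z = x 0 * z 0 + x 1 * z 1 := by
  simp [PiLp.inner_apply, Fin.sum_univ_two, mul_comm]

theorem plane_norm_sq (z : Plane) : ‖z‖ ^ 2 = z 0 ^ 2 + z 1 ^ 2 := by
  rw [EuclideanSpace.real_norm_sq_eq, Fin.sum_univ_two]

theorem HasDerivAt.plane_coord {γ : ℝ → Plane} {γ' : Plane} {u : ℝ} (h : HasDerivAt γ γ' u)
    (i : Fin 2) : HasDerivAt (fun v => γ v i) (γ' i) u :=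
  (EuclideanSpace.proj (𝕜 := ℝ) i).hasFDerivAt.comp_hasDerivAt u h

/-- A necessary second order condition at a local maximum. -/
theorem IsLocalMax.second_deriv_nonpos {f f' : ℝ → ℝ} {f'' a : ℝ} (h : IsLocalMax f a)
    (hf : ∀ x, HasDerivAt f (f' x) x) (hf' : HasDerivAt f' f'' a) : f'' ≤ 0 := by
  have hd : deriv f = f' := funext fun x => (hf x).deriv
  by_contra! hpos
  -- Otherwise the second derivative test makes `a` a local minimum as well, so `f` is locally
  -- constant and its second derivative vanishes.
  have hmin : IsLocalMin f a := isLocalMin_of_deriv_deriv_pos (by rwa [hd, hf'.deriv])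
    h.deriv_eq_zero (hf a).continuousAt
  have hc : f =ᶠ[nhds a] fun _ => f a := by
    filter_upwards [h, hmin] with x h1 h2 using le_antisymm h1 h2
  have h0 := hc.deriv.deriv_eq
  rw [hd, hf'.deriv] at h0
  simp at h0
  exact hpos.ne' h0

namespace ParametrizesBoundary

variable {γ : ℝ → Plane} {K : ConvexBody Plane}

theorem hasDerivAt (hγ : ParametrizesBoundary γ K) (u : ℝ) : HasDerivAt γ (deriv γ u) u :=
  (hγ.smooth.differentiable (by simp) u).hasDerivAt

theorem hasDerivAt_deriv (hγ : ParametrizesBoundary γ K) (u : ℝ) :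
    HasDerivAt (deriv γ) (iteratedDeriv 2 γ u) u := by
  rw [iteratedDeriv_succ, iteratedDeriv_one]
  exact ((contDiff_infty_iff_deriv.1 hγ.smooth).2.differentiable (by simp) u).hasDerivAt

/-- The tangent line of the curve at `γ u` supports the convex body, on the side given by the
orientation. A supporting functional at `γ u` exists by the Hahn-Banach theorem, it annihilates
`γ_u`, and the sign of `[γ_u, γ_uu]` fixes its direction by the second derivative test. -/
theorem bracket_lt (hγ : ParametrizesBoundary γ K) (u : ℝ) {x : Plane}
    (hx : x ∈ interior (K : Set Plane)) :
    bracket x (deriv γ u) < bracket (γ u) (deriv γ u) := by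
  have hfr : ∀ v, γ v ∈ frontier (K : Set Plane) := fun v => hγ.range_eq ▸ Set.mem_range_self v
  obtain ⟨f, hf⟩ := geometric_hahn_banach_open_point K.convex.interior isOpen_interior
    (hfr u).2
  have hle : ∀ y ∈ (K : Set Plane), f y ≤ f (γ u) := by
    have hcl : (K : Set Plane) ⊆ closure (interior (K : Set Plane)) := by
      rw [K.convex.closure_interior_eq_closure_of_nonempty_interior ⟨x, hx⟩]
      exact subset_closure
    exact fun y hy => closure_minimal (t := {y | f y ≤ f (γ u)}) (fun z hz => (hf z hz).le)
      (isClosed_le f.continuous continuous_const) (hcl hy)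
  have hK : ∀ v, γ v ∈ (K : Set Plane) := fun v => K.isClosed.frontier_subset (hfr v)
  have hmax : IsLocalMax (fun v => f (γ v)) u := Filter.Eventually.of_forall fun v => hle _ (hK v)
  have hd1 : ∀ v, HasDerivAt (fun v => f (γ v)) (f (deriv γ v)) v := fun v =>
    f.hasFDerivAt.comp_hasDerivAt v (hγ.hasDerivAt v)
  have hd2 : HasDerivAt (fun v => f (deriv γ v)) (f (iteratedDeriv 2 γ u)) u :=
    f.hasFDerivAt.comp_hasDerivAt u (hγ.hasDerivAt_deriv u)
  have h1 : f (deriv γ u) = 0 := hmax.hasDerivAt_eq_zero (hd1 u)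
  have h2 : f (iteratedDeriv 2 γ u) ≤ 0 := hmax.second_deriv_nonpos hd1 hd2
  have hcoord : ∀ y : Plane, f y = f !₂[1, 0] * y 0 + f !₂[0, 1] * y 1 := by
    intro y
    have hy : y = y 0 • (!₂[1, 0] : Plane) + y 1 • (!₂[0, 1] : Plane) := by
      ext i; fin_cases i <;> simp
    conv_lhs => rw [hy]
    simp [mul_comm]
  have hpos := hγ.bracket_pos u
  have hlt := hf x hx
  rw [hcoord] at h1 h2
  rw [hcoord x, hcoord (γ u)] at hlt
  generalize f !₂[1, 0] = z₀ at *
  generalize f !₂[0, 1] = z₁ at *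
  unfold bracket at *
  generalize deriv γ u = c at *
  generalize iteratedDeriv 2 γ u = d at *
  -- Up to the positive factor `[γ_u, γ_uu]`, the functional is `-f γ_uu` times `[·, γ_u]`.
  have hk : -(z₀ * d 0 + z₁ * d 1) * ((γ u 0 * c 1 - γ u 1 * c 0) - (x 0 * c 1 - x 1 * c 0)) =
      (c 0 * d 1 - c 1 * d 0) * ((z₀ * γ u 0 + z₁ * γ u 1) - (z₀ * x 0 + z₁ * x 1)) := by
    linear_combination (-d 1 * (γ u 0 - x 0) + d 0 * (γ u 1 - x 1)) * h1
  have := pos_of_mul_pos_right (hk ▸ mul_pos hpos (sub_pos.2 hlt)) (by linarith)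
  linarith

theorem bracket_le (hγ : ParametrizesBoundary γ K) (h0 : (interior (K : Set Plane)).Nonempty)
    (u : ℝ) {x : Plane} (hx : x ∈ (K : Set Plane)) :
    bracket x (deriv γ u) ≤ bracket (γ u) (deriv γ u) := by
  have hcl : (K : Set Plane) ⊆ closure (interior (K : Set Plane)) := by
    rw [K.convex.closure_interior_eq_closure_of_nonempty_interior h0]
    exact subset_closure
  refine closure_minimal (t := {y | bracket y (deriv γ u) ≤ bracket (γ u) (deriv γ u)})
    (fun z hz => (hγ.bracket_lt u hz).le) (isClosed_le ?_ continuous_const) (hcl hx)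
  unfold bracket
  fun_prop

/-- The support function in a direction normal to the curve at `γ u` is attained at `γ u`. -/
theorem supportFn_eq (hγ : ParametrizesBoundary γ K) (h0 : (interior (K : Set Plane)).Nonempty)
    (u : ℝ) {z : Plane} {k : ℝ} (hk : 0 ≤ k) (hz0 : z 0 = k * deriv γ u 1)
    (hz1 : z 1 = -(k * deriv γ u 0)) :
    supportFn K z = γ u 0 * z 0 + γ u 1 * z 1 := by
  have hin : ∀ x : Plane, inner ℝ x z = k * bracket x (deriv γ u) := by
    intro x
    rw [inner_plane, hz0, hz1, bracket]
    ring
  have hmem : γ u ∈ (K : Set Plane) :=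
    K.isClosed.frontier_subset (hγ.range_eq ▸ Set.mem_range_self u)
  have hg : IsGreatest ((fun x : Plane => inner ℝ x z) '' (K : Set Plane)) (inner ℝ (γ u) z) := by
    refine ⟨⟨_, hmem, rfl⟩, ?_⟩
    rintro _ ⟨x, hx, rfl⟩
    simp only [hin]
    exact mul_le_mul_of_nonneg_left (hγ.bracket_le h0 u hx) hk
  rw [supportFn, hg.csSup_eq, inner_plane]

theorem norm_deriv_pos (hγ : ParametrizesBoundary γ K) (u : ℝ) : 0 < ‖deriv γ u‖ := by
  refine norm_pos_iff.2 fun h => ?_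
  have := hγ.bracket_pos u
  simp [h, bracket] at this

theorem unitNormal_zero (u : ℝ) : unitNormal γ u 0 = ‖deriv γ u‖⁻¹ * deriv γ u 1 := by
  simp [unitNormal, rot90]

theorem unitNormal_one (u : ℝ) : unitNormal γ u 1 = -(‖deriv γ u‖⁻¹ * deriv γ u 0) := by
  simp [unitNormal, rot90]

theorem supportFn_unitNormal (hγ : ParametrizesBoundary γ K)
    (h0 : (interior (K : Set Plane)).Nonempty) (u : ℝ) :
    supportFn K (unitNormal γ u) = ‖deriv γ u‖⁻¹ * bracket (γ u) (deriv γ u) := by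
  rw [hγ.supportFn_eq h0 u (inv_nonneg.2 (norm_nonneg _)) (unitNormal_zero u) (unitNormal_one u),
    unitNormal_zero, unitNormal_one, bracket]
  ring

/-- The contact point as a smooth function `V` of the angle: near `φ = 0`, the curve at parameter
`V φ` has outward normal direction `cos φ • ν + sin φ • rot90 ν`, where `ν` is the unit normal
at `u`. It is the local inverse of the turning angle
`v ↦ arctan ([γ_u(u), γ_u(v)] / ⟨γ_u(u), γ_u(v)⟩)`. -/
theorem exists_contact_parameter (hγ : ParametrizesBoundary γ K) (u : ℝ) :
    ∃ V : ℝ → ℝ, ContDiffAt ℝ ∞ V 0 ∧ V 0 = u ∧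
      HasDerivAt V (‖deriv γ u‖ ^ 2 / bracket (deriv γ u) (iteratedDeriv 2 γ u)) 0 ∧
      ∀ᶠ φ in nhds (0 : ℝ), ∃ k : ℝ, 0 ≤ k ∧
        Real.cos φ * unitNormal γ u 0 - Real.sin φ * unitNormal γ u 1 = k * deriv γ (V φ) 1 ∧
        Real.cos φ * unitNormal γ u 1 + Real.sin φ * unitNormal γ u 0
          = -(k * deriv γ (V φ) 0) := by
  set c := deriv γ u with hc
  have hL := hγ.norm_deriv_pos u
  rw [← hc] at hL
  have hL2 := plane_norm_sq c
  set S : ℝ → ℝ := fun v => c 0 * deriv γ v 1 - c 1 * deriv γ v 0 with hS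
  set C : ℝ → ℝ := fun v => c 0 * deriv γ v 0 + c 1 * deriv γ v 1 with hC
  have hsm : ∀ i : Fin 2, ContDiff ℝ ∞ fun v => deriv γ v i := fun i =>
    (EuclideanSpace.proj (𝕜 := ℝ) i).contDiff.comp (contDiff_infty_iff_deriv.1 hγ.smooth).2
  have hSs : ContDiff ℝ ∞ S := ((contDiff_const.mul (hsm 1)).sub (contDiff_const.mul (hsm 0)))
  have hCs : ContDiff ℝ ∞ C := ((contDiff_const.mul (hsm 0)).add (contDiff_const.mul (hsm 1)))
  have hSu : S u = 0 := by simp only [hS, ← hc]; ring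
  have hCu : C u = ‖c‖ ^ 2 := by simp only [hC, ← hc]; rw [hL2]; ring
  have hCpos : 0 < C u := by rw [hCu]; positivity
  set b := bracket c (iteratedDeriv 2 γ u) with hb
  have hbpos : 0 < b := hγ.bracket_pos u
  have hSd : HasDerivAt S b u :=
    (((hγ.hasDerivAt_deriv u).plane_coord 1).const_mul (c 0)).sub
      (((hγ.hasDerivAt_deriv u).plane_coord 0).const_mul (c 1))
  set Φ : ℝ → ℝ := fun v => Real.arctan (S v / C v) with hΦ
  have hΦs : ContDiffAt ℝ ∞ Φ u :=
    Real.contDiff_arctan.contDiffAt.comp u (hSs.contDiffAt.div hCs.contDiffAt hCpos.ne')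
  have hΦu : Φ u = 0 := by simp [hΦ, hSu]
  have hCd : HasDerivAt C (deriv C u) u := (hCs.differentiable (by simp) u).hasDerivAt
  have hd : HasDerivAt Φ (b / ‖c‖ ^ 2) u := by
    refine (hSd.div hCd hCpos.ne').arctan.congr_deriv ?_
    simp only [hSu, hCu]
    field_simp
    simp [hSu]
  have hd0 : b / ‖c‖ ^ 2 ≠ 0 := by positivity
  have hdF : HasFDerivAt Φ ((ContinuousLinearEquiv.unitsEquivAut ℝ (Units.mk0 _ hd0) :
      ℝ ≃L[ℝ] ℝ) : ℝ →L[ℝ] ℝ) u :=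
    hd.hasFDerivAt.congr_fderiv (by ext; simp)
  have hst := hΦs.hasStrictFDerivAt' hdF (by simp)
  have hVs := hΦs.to_localInverse hdF (by simp)
  have hVr := hst.eventually_right_inverse
  have hVu : hΦs.localInverse hdF (by simp) (Φ u) = u := hst.localInverse_apply_image
  change ∀ᶠ y in nhds (Φ u), Φ (hΦs.localInverse hdF (by simp) y) = y at hVr
  generalize hΦs.localInverse hdF (by simp) = V at *
  rw [hΦu] at hVs hVr hVu
  have hVc : ContinuousAt V 0 := hVs.continuousAt
  refine ⟨V, hVs, hVu, ?_, ?_⟩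
  · have hV : HasDerivAt V (deriv V 0) 0 := (hVs.differentiableAt (by simp)).hasDerivAt
    have h1 : HasDerivAt (fun y => Φ (V y)) (b / ‖c‖ ^ 2 * deriv V 0) 0 :=
      HasDerivAt.comp (h₂ := Φ) 0 (by rwa [hVu]) hV
    have h2 := h1.unique ((hasDerivAt_id (0 : ℝ)).congr_of_eventuallyEq hVr)
    refine hV.congr_deriv ?_
    field_simp at h2 ⊢
    linarith
  · have hev : ∀ᶠ φ in nhds (0 : ℝ), 0 < C (V φ) :=
      (hCs.continuous.continuousAt.comp hVc).eventually (lt_mem_nhds (by simpa [hVu] using hCpos))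
    have hcos : ∀ᶠ φ in nhds (0 : ℝ), 0 < Real.cos φ :=
      Real.continuous_cos.continuousAt.eventually (lt_mem_nhds (by simp))
    filter_upwards [hev, hcos, hVr] with φ h1 h2 h3
    have htan : Real.sin φ / Real.cos φ = S (V φ) / C (V φ) := by
      rw [← Real.tan_eq_sin_div_cos, ← h3]
      simp only [hΦ, Real.tan_arctan]
      rw [show V (Real.arctan (S (V φ) / C (V φ))) = V φ from congrArg V h3]
    have hsin : Real.sin φ * C (V φ) = Real.cos φ * S (V φ) := by
      field_simp at htan
      linarith
    refine ⟨Real.cos φ * ‖c‖ / C (V φ), by positivity, ?_, ?_⟩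
    · rw [unitNormal_zero, unitNormal_one, ← hc]
      field_simp
      rw [hL2]
      simp only [hS, hC] at hsin ⊢
      linear_combination c 0 * hsin
    · rw [unitNormal_zero, unitNormal_one, ← hc]
      field_simp
      rw [hL2]
      simp only [hS, hC] at hsin ⊢
      linear_combination c 1 * hsin

theorem radiusOfCurvature_unitNormal (hγ : ParametrizesBoundary γ K)
    (h0 : (interior (K : Set Plane)).Nonempty) (u : ℝ) :
    radiusOfCurvature K (unitNormal γ u) =
      ‖deriv γ u‖ ^ 3 / bracket (deriv γ u) (iteratedDeriv 2 γ u) := by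
  obtain ⟨V, hVs, hVu, hVd, hV⟩ := hγ.exists_contact_parameter u
  set z := unitNormal γ u with hz
  have hb := hγ.bracket_pos u
  have hL := hγ.norm_deriv_pos u
  set h : ℝ → ℝ := fun φ => supportFn K (Real.cos φ • z + Real.sin φ • rot90 z) with hh
  set e₀ : ℝ → ℝ := fun φ => Real.cos φ * z 0 - Real.sin φ * z 1 with he₀
  set e₁ : ℝ → ℝ := fun φ => Real.cos φ * z 1 + Real.sin φ * z 0 with he₁
  have hde₀ : ∀ φ, HasDerivAt e₀ (-e₁ φ) φ := fun φ =>
    (((Real.hasDerivAt_cos φ).mul_const (z 0)).sub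
      ((Real.hasDerivAt_sin φ).mul_const (z 1))).congr_deriv (by simp only [he₁]; ring)
  have hde₁ : ∀ φ, HasDerivAt e₁ (e₀ φ) φ := fun φ =>
    (((Real.hasDerivAt_cos φ).mul_const (z 1)).add
      ((Real.hasDerivAt_sin φ).mul_const (z 0))).congr_deriv (by simp only [he₀]; ring)
  have hgc : ∀ v i, HasDerivAt (fun v => γ v i) (deriv γ v i) v := fun v i =>
    (hγ.hasDerivAt v).plane_coord i
  have hval : h =ᶠ[nhds 0] fun φ => γ (V φ) 0 * e₀ φ + γ (V φ) 1 * e₁ φ := by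
    filter_upwards [hV] with φ ⟨k, hk, h1, h2⟩
    have hx0 : (Real.cos φ • z + Real.sin φ • rot90 z) 0 = e₀ φ := by
      simp [rot90, he₀]; ring
    have hx1 : (Real.cos φ • z + Real.sin φ • rot90 z) 1 = e₁ φ := by
      simp [rot90, he₁]
    simp only [hh]
    rw [hγ.supportFn_eq h0 (V φ) hk (hx0.trans h1) (hx1.trans h2), hx0, hx1]
  have hVev : ∀ᶠ φ in nhds (0 : ℝ), DifferentiableAt ℝ V φ := by
    have h1 : ContDiffAt ℝ 1 V 0 := hVs.of_le (by exact mod_cast le_top)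
    exact (h1.eventually (by simp)).mono fun φ h => h.differentiableAt (by simp)
  -- The variation of the contact point does not contribute, as the curve is tangent to the
  -- supporting line.
  have hder : deriv h =ᶠ[nhds 0] fun φ => -(γ (V φ) 0 * e₁ φ) + γ (V φ) 1 * e₀ φ := by
    filter_upwards [hval.eventuallyEq_nhds, hVev, hV] with φ h1 h2 ⟨k, _, hk0, hk1⟩
    rw [h1.deriv_eq]
    have ha := ((hgc (V φ) 0).comp φ h2.hasDerivAt).mul (hde₀ φ)
    have hb := ((hgc (V φ) 1).comp φ h2.hasDerivAt).mul (hde₁ φ)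
    refine (ha.add hb).deriv.trans ?_
    have hk0' : e₀ φ = k * deriv γ (V φ) 1 := hk0
    have hk1' : e₁ φ = -(k * deriv γ (V φ) 0) := hk1
    simp only [Function.comp]
    rw [hk0', hk1']
    ring
  have h2 : iteratedDeriv 2 h 0 = ‖deriv γ u‖ ^ 3 / bracket (deriv γ u) (iteratedDeriv 2 γ u)
      - (γ u 0 * z 0 + γ u 1 * z 1) := by
    rw [iteratedDeriv_succ, iteratedDeriv_one, hder.deriv_eq]
    have ha := ((hgc (V 0) 0).comp 0 hVd).mul (hde₁ 0)
    have hb := ((hgc (V 0) 1).comp 0 hVd).mul (hde₀ 0)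
    refine (ha.neg.add hb).deriv.trans ?_
    have hL2 := plane_norm_sq (deriv γ u)
    simp only [Function.comp, he₀, he₁, hVu, Real.cos_zero, Real.sin_zero]
    rw [hz, unitNormal_zero, unitNormal_one]
    field_simp
    linear_combination -‖deriv γ u‖ ^ 2 * hL2
  rw [radiusOfCurvature, h2, hγ.supportFn_eq h0 u (inv_nonneg.2 (norm_nonneg _))
    (unitNormal_zero u) (unitNormal_one u)]
  ring

theorem affineDensity_pos (hγ : ParametrizesBoundary γ K) (u : ℝ) : 0 < affineDensity γ u :=
  Real.rpow_pos_of_pos (hγ.bracket_pos u) _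

/-- The affine support function is `[γ, γ_𝔰]`. -/
theorem affineSupport_eq (hγ : ParametrizesBoundary γ K)
    (h0 : (interior (K : Set Plane)).Nonempty) (u : ℝ) :
    affineSupport K γ u = (affineDensity γ u)⁻¹ * bracket (γ u) (deriv γ u) := by
  have hL := hγ.norm_deriv_pos u
  rw [affineSupport, hγ.supportFn_unitNormal h0, hγ.radiusOfCurvature_unitNormal h0,
    Real.div_rpow (by positivity) (hγ.bracket_pos u).le, ← Real.rpow_natCast,
    ← Real.rpow_mul hL.le]
  norm_num
  rw [affineDensity]
  field_simp

theorem affineSupport_pos (hγ : ParametrizesBoundary γ K)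
    (h0 : (0 : Plane) ∈ interior (K : Set Plane)) (u : ℝ) : 0 < affineSupport K γ u := by
  rw [hγ.affineSupport_eq ⟨0, h0⟩]
  refine mul_pos (inv_pos.2 (hγ.affineDensity_pos u)) ?_
  simpa [bracket] using hγ.bracket_lt u h0

end ParametrizesBoundary

/-! ### Affine arc length and its evolution -/

/-- The derivative `g⁻¹ ∂_u F` of a family with respect to the arc length with density `g`. -/
noncomputable def arcDeriv (g F : ℝ → ℝ → ℝ) (t u : ℝ) : ℝ := (g t u)⁻¹ * paramDeriv F t u

namespace SmoothFamily

variable {T t α : ℝ} {g F x y f w l σ : ℝ → ℝ → ℝ}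

theorem arc (hF : SmoothFamily T F) (hg : SmoothFamily T g) (hg0 : ∀ t < T, ∀ u, 0 < g t u) :
    SmoothFamily T (arcDeriv g F) :=
  (hg.inv fun t ht u => (hg0 t ht u).ne').mul hF.param

theorem hasDerivAt_arc (hF : SmoothFamily T F) (hg0 : ∀ t < T, ∀ u, 0 < g t u) (ht : t < T)
    (u : ℝ) : HasDerivAt (F t) (g t u * arcDeriv g F t u) u := by
  have := (hg0 t ht u).ne'
  refine (hF.hasDerivAt_param ht u).congr_deriv ?_
  rw [arcDeriv]
  field_simp

theorem arcDeriv_eq_of_hasDerivAt (hg0 : ∀ t < T, ∀ u, 0 < g t u) (ht : t < T) {u c : ℝ}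
    {G : ℝ → ℝ} (hG : HasDerivAt G (g t u * c) u) (h : ∀ v, F t v = G v) :
    arcDeriv g F t u = c := by
  have := (hg0 t ht u).ne'
  rw [arcDeriv, paramDeriv, show F t = G from funext h, hG.deriv]
  field_simp

theorem timeDeriv_eq_of_hasDerivAt (ht : t < T) {u c : ℝ} {G : ℝ → ℝ} (hG : HasDerivAt G c t)
    (h : ∀ τ < T, F τ u = G τ) : timeDeriv F t u = c :=
  (hG.congr_of_eventuallyEq (Filter.eventually_of_mem (Iio_mem_nhds ht) h)).deriv

/-- The commutator of the time derivative and the arc length derivative. -/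
theorem timeDeriv_arcDeriv (hF : SmoothFamily T F) (hg : SmoothFamily T g)
    (hg0 : ∀ t < T, ∀ u, 0 < g t u) (ht : t < T) (u : ℝ) :
    timeDeriv (arcDeriv g F) t u =
      arcDeriv g (timeDeriv F) t u - timeDeriv g t u / g t u * arcDeriv g F t u := by
  have h0 := (hg0 t ht u).ne'
  have h := ((hg.hasDerivAt_time ht u).inv h0).mul (hF.param.hasDerivAt_time ht u)
  rw [timeDeriv_eq_of_hasDerivAt ht h fun _ _ => rfl, hF.timeDeriv_paramDeriv ht]
  simp only [arcDeriv, Pi.inv_apply]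
  field_simp
  ring

theorem arcDeriv_rpow (hF : SmoothFamily T F) (hF0 : ∀ t < T, ∀ u, 0 < F t u)
    (hg0 : ∀ t < T, ∀ u, 0 < g t u) (c : ℝ) (ht : t < T) (u : ℝ) :
    arcDeriv g (fun t u => F t u ^ c) t u =
      c * F t u ^ c * ((F t u)⁻¹ * arcDeriv g F t u) := by
  have h0 := hF0 t ht u
  refine arcDeriv_eq_of_hasDerivAt hg0 ht
    (((hF.hasDerivAt_arc hg0 ht u).rpow_const (Or.inl h0.ne')).congr_deriv ?_) fun _ => rfl
  rw [Real.rpow_sub_one h0.ne']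
  ring

theorem timeDeriv_rpow (hF : SmoothFamily T F) (hF0 : ∀ t < T, ∀ u, 0 < F t u)
    (c : ℝ) (ht : t < T) (u : ℝ) :
    timeDeriv (fun t u => F t u ^ c) t u =
      c * F t u ^ c * ((F t u)⁻¹ * timeDeriv F t u) := by
  have h0 := hF0 t ht u
  refine timeDeriv_eq_of_hasDerivAt ht
    (((hF.hasDerivAt_time ht u).rpow_const (Or.inl h0.ne')).congr_deriv ?_) fun _ _ => rfl
  rw [Real.rpow_sub_one h0.ne']
  ring

/-- In affine arc length, `[γ_𝔰, γ_𝔰𝔰] = 1`. -/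
theorem arcDeriv_bracket_eq_one (hx : SmoothFamily T x) (hy : SmoothFamily T y)
    (hg : SmoothFamily T g) (hg0 : ∀ t < T, ∀ u, 0 < g t u)
    (hgxy : ∀ t < T, ∀ u, g t u ^ 3 = paramDeriv x t u * paramDeriv (paramDeriv y) t u
      - paramDeriv y t u * paramDeriv (paramDeriv x) t u) (ht : t < T) (u : ℝ) :
    arcDeriv g x t u * arcDeriv g (arcDeriv g y) t u
      - arcDeriv g y t u * arcDeriv g (arcDeriv g x) t u = 1 := by
  have h0 := (hg0 t ht u).ne'
  have key : ∀ z, SmoothFamily T z → arcDeriv g (arcDeriv g z) t u =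
      (g t u)⁻¹ * (-paramDeriv g t u / g t u ^ 2 * paramDeriv z t u
        + (g t u)⁻¹ * paramDeriv (paramDeriv z) t u) := fun z hz => by
    rw [arcDeriv]
    congr 1
    exact (((hg.hasDerivAt_param ht u).inv h0).mul (hz.param.hasDerivAt_param ht u)).deriv
  rw [key x hx, key y hy, arcDeriv, arcDeriv]
  have := hgxy t ht u
  field_simp
  linear_combination -g t u * this

/-- `γ_𝔰𝔰𝔰 = -μ γ_𝔰`, with the affine curvature `μ = [γ_𝔰𝔰, γ_𝔰𝔰𝔰]`, and
`σ_𝔰𝔰 = 1 - μ σ` for `σ = [γ, γ_𝔰]`. -/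
theorem affine_frenet (hx : SmoothFamily T x) (hy : SmoothFamily T y)
    (hg : SmoothFamily T g) (hg0 : ∀ t < T, ∀ u, 0 < g t u)
    (hgxy : ∀ t < T, ∀ u, g t u ^ 3 = paramDeriv x t u * paramDeriv (paramDeriv y) t u
      - paramDeriv y t u * paramDeriv (paramDeriv x) t u)
    (hσ : ∀ t < T, ∀ u, σ t u = x t u * arcDeriv g y t u - y t u * arcDeriv g x t u) :
    ∃ μ, SmoothFamily T μ ∧ ∀ t < T, ∀ u,
      arcDeriv g (arcDeriv g (arcDeriv g x)) t u = -μ t u * arcDeriv g x t u ∧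
      arcDeriv g (arcDeriv g (arcDeriv g y)) t u = -μ t u * arcDeriv g y t u ∧
      arcDeriv g σ t u = x t u * arcDeriv g (arcDeriv g y) t u
        - y t u * arcDeriv g (arcDeriv g x) t u ∧
      arcDeriv g (arcDeriv g σ) t u = 1 - μ t u * σ t u := by
  have hone := fun t (ht : t < T) u => arcDeriv_bracket_eq_one hx hy hg hg0 hgxy ht u
  have ha := hx.arc hg hg0
  have hb := hy.arc hg hg0
  have hA := ha.arc hg hg0
  have hB := hb.arc hg hg0
  have h1 : ∀ t < T, ∀ u, arcDeriv g x t u * arcDeriv g (arcDeriv g (arcDeriv g y)) t u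
      - arcDeriv g y t u * arcDeriv g (arcDeriv g (arcDeriv g x)) t u = 0 := by
    intro t ht u
    have h := ((ha.hasDerivAt_arc hg0 ht u).mul (hB.hasDerivAt_arc hg0 ht u)).sub
      ((hb.hasDerivAt_arc hg0 ht u).mul (hA.hasDerivAt_arc hg0 ht u))
    have h' := h.unique ((hasDerivAt_const u (1 : ℝ)).congr_of_eventuallyEq
      (Filter.Eventually.of_forall fun v => hone t ht v))
    have := hg0 t ht u
    refine (mul_eq_zero.1 (?_ : g t u * _ = 0)).resolve_left this.ne'
    linear_combination h'
  have h2 : ∀ t < T, ∀ u, arcDeriv g σ t u = x t u * arcDeriv g (arcDeriv g y) t u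
      - y t u * arcDeriv g (arcDeriv g x) t u := fun t ht u =>
    arcDeriv_eq_of_hasDerivAt hg0 ht
      ((((hx.hasDerivAt_arc hg0 ht u).mul (hb.hasDerivAt_arc hg0 ht u)).sub
        ((hy.hasDerivAt_arc hg0 ht u).mul (ha.hasDerivAt_arc hg0 ht u))).congr_deriv (by ring))
      fun v => hσ t ht v
  refine ⟨fun t u => arcDeriv g (arcDeriv g x) t u * arcDeriv g (arcDeriv g (arcDeriv g y)) t u
    - arcDeriv g (arcDeriv g y) t u * arcDeriv g (arcDeriv g (arcDeriv g x)) t u,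
    (hA.mul (hB.arc hg hg0)).sub (hB.mul (hA.arc hg hg0)), fun t ht u => ?_⟩
  have e0 := hone t ht u
  have e1 := h1 t ht u
  have hDA : arcDeriv g (arcDeriv g (arcDeriv g x)) t u =
      -(arcDeriv g (arcDeriv g x) t u * arcDeriv g (arcDeriv g (arcDeriv g y)) t u
      - arcDeriv g (arcDeriv g y) t u * arcDeriv g (arcDeriv g (arcDeriv g x)) t u)
        * arcDeriv g x t u := by
    linear_combination -arcDeriv g (arcDeriv g (arcDeriv g x)) t u * e0
      + arcDeriv g (arcDeriv g x) t u * e1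
  have hDB : arcDeriv g (arcDeriv g (arcDeriv g y)) t u =
      -(arcDeriv g (arcDeriv g x) t u * arcDeriv g (arcDeriv g (arcDeriv g y)) t u
      - arcDeriv g (arcDeriv g y) t u * arcDeriv g (arcDeriv g (arcDeriv g x)) t u)
        * arcDeriv g y t u := by
    linear_combination -arcDeriv g (arcDeriv g (arcDeriv g y)) t u * e0
      + arcDeriv g (arcDeriv g y) t u * e1
  refine ⟨hDA, hDB, h2 t ht u, ?_⟩
  refine arcDeriv_eq_of_hasDerivAt hg0 ht
      ((((hx.hasDerivAt_arc hg0 ht u).mul (hB.hasDerivAt_arc hg0 ht u)).sub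
        ((hy.hasDerivAt_arc hg0 ht u).mul (hA.hasDerivAt_arc hg0 ht u))).congr_deriv ?_)
      fun v => h2 t ht v
  rw [hσ t ht u]
  linear_combination g t u * (x t u * hDB - y t u * hDA + e0)

/-- The evolution of the arc length density `g` and of `σ = [γ, γ_𝔰]` under an affine normal
flow `∂_t γ = f γ_𝔰𝔰`. The first equation is the time derivative of `[γ_𝔰, γ_𝔰𝔰] = 1`. -/
theorem evolution_of_normal_flow (hx : SmoothFamily T x) (hy : SmoothFamily T y)
    (hg : SmoothFamily T g) (hf : SmoothFamily T f) (hg0 : ∀ t < T, ∀ u, 0 < g t u)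
    (hgxy : ∀ t < T, ∀ u, g t u ^ 3 = paramDeriv x t u * paramDeriv (paramDeriv y) t u
      - paramDeriv y t u * paramDeriv (paramDeriv x) t u)
    (hσ : ∀ t < T, ∀ u, σ t u = x t u * arcDeriv g y t u - y t u * arcDeriv g x t u)
    (hxt : ∀ t < T, ∀ u, timeDeriv x t u = f t u * arcDeriv g (arcDeriv g x) t u)
    (hyt : ∀ t < T, ∀ u, timeDeriv y t u = f t u * arcDeriv g (arcDeriv g y) t u) :
    ∃ μ : ℝ → ℝ → ℝ, ∀ t < T, ∀ u,
      arcDeriv g (arcDeriv g σ) t u = 1 - μ t u * σ t u ∧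
      3 * (timeDeriv g t u / g t u) = arcDeriv g (arcDeriv g f) t u - 2 * f t u * μ t u ∧
      timeDeriv σ t u = -f t u + arcDeriv g f t u * arcDeriv g σ t u
        - (f t u * μ t u + timeDeriv g t u / g t u) * σ t u := by
  obtain ⟨μ, hμ, hF⟩ := affine_frenet hx hy hg hg0 hgxy hσ
  have ha := hx.arc hg hg0
  have hb := hy.arc hg hg0
  have hA := ha.arc hg hg0
  have hB := hb.arc hg hg0
  have hf1 := hf.arc hg hg0
  set h : ℝ → ℝ → ℝ := fun t u => timeDeriv g t u * (g t u)⁻¹ with hh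
  have hsm : SmoothFamily T h := hg.time.mul (hg.inv fun t ht u => (hg0 t ht u).ne')
  have hdiv : ∀ t u, timeDeriv g t u / g t u = h t u := fun t u => div_eq_mul_inv _ _
  -- The evolution of a coordinate `z_𝔰` of the tangent and `z_𝔰𝔰` of the affine normal.
  have key1 : ∀ z, SmoothFamily T z →
      (∀ t < T, ∀ u, timeDeriv z t u = f t u * arcDeriv g (arcDeriv g z) t u) →
      (∀ t < T, ∀ u, arcDeriv g (arcDeriv g (arcDeriv g z)) t u = -μ t u * arcDeriv g z t u) →
      ∀ t < T, ∀ u, timeDeriv (arcDeriv g z) t u =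
        arcDeriv g f t u * arcDeriv g (arcDeriv g z) t u
        - (f t u * μ t u + h t u) * arcDeriv g z t u := by
    intro z hz hzt hzs t ht u
    rw [timeDeriv_arcDeriv hz hg hg0 ht, hdiv]
    have h1 := arcDeriv_eq_of_hasDerivAt (F := timeDeriv z) (u := u) hg0 ht
      (((hf.hasDerivAt_arc hg0 ht u).mul
        (((hz.arc hg hg0).arc hg hg0).hasDerivAt_arc hg0 ht u)).congr_deriv
        (by rw [hzs t ht u]; ring : _ = g t u * (arcDeriv g f t u * arcDeriv g (arcDeriv g z) t u
          - f t u * μ t u * arcDeriv g z t u))) fun v => hzt t ht v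
    rw [h1]
    ring
  have key2 : ∀ z, SmoothFamily T z →
      (∀ t < T, ∀ u, timeDeriv z t u = f t u * arcDeriv g (arcDeriv g z) t u) →
      (∀ t < T, ∀ u, arcDeriv g (arcDeriv g (arcDeriv g z)) t u = -μ t u * arcDeriv g z t u) →
      ∀ t < T, ∀ u, timeDeriv (arcDeriv g (arcDeriv g z)) t u =
        (arcDeriv g (arcDeriv g f) t u - f t u * μ t u - 2 * h t u)
          * arcDeriv g (arcDeriv g z) t u
        - (2 * arcDeriv g f t u * μ t u + f t u * arcDeriv g μ t u + arcDeriv g h t u)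
          * arcDeriv g z t u := by
    intro z hz hzt hzs t ht u
    have hz1 := hz.arc hg hg0
    have hz2 := hz1.arc hg hg0
    rw [timeDeriv_arcDeriv hz1 hg hg0 ht, hdiv]
    have h1 := arcDeriv_eq_of_hasDerivAt (F := timeDeriv (arcDeriv g z)) (u := u) hg0 ht
      ((((hf1.hasDerivAt_arc hg0 ht u).mul (hz2.hasDerivAt_arc hg0 ht u)).sub
        ((((hf.hasDerivAt_arc hg0 ht u).mul (hμ.hasDerivAt_arc hg0 ht u)).add
          (hsm.hasDerivAt_arc hg0 ht u)).mul (hz1.hasDerivAt_arc hg0 ht u))).congr_deriv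
        (by
          simp only [Pi.add_apply, Pi.mul_apply]
          rw [hzs t ht u]
          ring : _ = g t u * (arcDeriv g (arcDeriv g f) t u * arcDeriv g (arcDeriv g z) t u
          - arcDeriv g f t u * μ t u * arcDeriv g z t u
          - (arcDeriv g f t u * μ t u + f t u * arcDeriv g μ t u + arcDeriv g h t u)
            * arcDeriv g z t u
          - (f t u * μ t u + h t u) * arcDeriv g (arcDeriv g z) t u)))
      fun v => key1 z hz hzt hzs t ht v
    rw [h1]
    ring
  refine ⟨μ, fun t ht u => ⟨(hF t ht u).2.2.2, ?_, ?_⟩⟩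
  · have e := ((ha.hasDerivAt_time ht u).mul (hB.hasDerivAt_time ht u)).sub
      ((hb.hasDerivAt_time ht u).mul (hA.hasDerivAt_time ht u))
    have e' := e.unique ((hasDerivAt_const t (1 : ℝ)).congr_of_eventuallyEq
      (Filter.eventually_of_mem (Iio_mem_nhds ht)
        fun τ hτ => arcDeriv_bracket_eq_one hx hy hg hg0 hgxy hτ u))
    rw [key1 x hx hxt (fun t ht u => (hF t ht u).1) t ht u,
      key1 y hy hyt (fun t ht u => (hF t ht u).2.1) t ht u,
      key2 x hx hxt (fun t ht u => (hF t ht u).1) t ht u,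
      key2 y hy hyt (fun t ht u => (hF t ht u).2.1) t ht u] at e'
    have e0 := arcDeriv_bracket_eq_one hx hy hg hg0 hgxy ht u
    rw [hdiv]
    linear_combination -e' + (arcDeriv g (arcDeriv g f) t u - 2 * f t u * μ t u - 3 * h t u) * e0
  · have e := timeDeriv_eq_of_hasDerivAt ht (((hx.hasDerivAt_time ht u).mul
      (hb.hasDerivAt_time ht u)).sub ((hy.hasDerivAt_time ht u).mul (ha.hasDerivAt_time ht u)))
      fun τ hτ => hσ τ hτ u
    rw [key1 x hx hxt (fun t ht u => (hF t ht u).1) t ht u,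
      key1 y hy hyt (fun t ht u => (hF t ht u).2.1) t ht u, hxt t ht, hyt t ht] at e
    have e0 := arcDeriv_bracket_eq_one hx hy hg hg0 hgxy ht u
    rw [e, hdiv, (hF t ht u).2.2.1, hσ t ht u]
    linear_combination -f t u * e0

/-- The evolution of the Harnack quantity
`q = (4α/3 - 1) w - (α²/3) f (l_𝔰 + (2 - α) l²)`, where `σ` evolves by the flow,
`w = σ ^ (-α)`, `f = σ ^ (1 - α)` and `l = (log σ)_𝔰`, and where `h` is the logarithmic time
derivative of the arc length density. -/
theorem evolution_of_harnack (hα : α ≠ 0) (hg : SmoothFamily T g) (hw : SmoothFamily T w)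
    (hf : SmoothFamily T f) (hl : SmoothFamily T l) (hg0 : ∀ t < T, ∀ u, 0 < g t u)
    {p h q : ℝ → ℝ → ℝ}
    (hp : ∀ t < T, ∀ u, p t u = -4 / 3 * w t u
      + f t u * (α / 3 * arcDeriv g l t u + (1 - α / 3 - α ^ 2 / 3) * l t u ^ 2))
    (hh : ∀ t < T, ∀ u, h t u = -2 / 3 * w t u
      + f t u * ((3 - α) * arcDeriv g l t u + (α ^ 2 - 2 * α + 3) * l t u ^ 2) / 3)
    (hq : ∀ t < T, ∀ u, q t u = (4 * α / 3 - 1) * w t u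
      - α ^ 2 / 3 * f t u * (arcDeriv g l t u + (2 - α) * l t u ^ 2))
    (hws : ∀ t < T, ∀ u, arcDeriv g w t u = -α * w t u * l t u)
    (hfs : ∀ t < T, ∀ u, arcDeriv g f t u = (1 - α) * f t u * l t u)
    (hwt : ∀ t < T, ∀ u, timeDeriv w t u = -α * w t u * p t u)
    (hft : ∀ t < T, ∀ u, timeDeriv f t u = (1 - α) * f t u * p t u)
    (hlt : ∀ t < T, ∀ u, timeDeriv l t u = arcDeriv g p t u - h t u * l t u)
    (hgt : ∀ t < T, ∀ u, timeDeriv g t u / g t u = h t u) (ht : t < T) (u : ℝ) :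
    timeDeriv q t u = α / 3 * f t u * arcDeriv g (arcDeriv g q) t u
      + (1 + 2 * α / 3) * (1 - α) * f t u * l t u * arcDeriv g q t u
      + q t u ^ 2 + (α - 1) * w t u ^ 2 + 3 / α * (q t u - (α - 1) * w t u) ^ 2 := by
  have hl1 := hl.arc hg hg0
  have hl2 := hl1.arc hg hg0
  have dw : ∀ v, HasDerivAt (w t) (g t v * (-α * w t v * l t v)) v := fun v =>
    hws t ht v ▸ hw.hasDerivAt_arc hg0 ht v
  have df : ∀ v, HasDerivAt (f t) (g t v * ((1 - α) * f t v * l t v)) v := fun v =>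
    hfs t ht v ▸ hf.hasDerivAt_arc hg0 ht v
  have dl := hl.hasDerivAt_arc hg0 ht
  have dl1 := hl1.hasDerivAt_arc hg0 ht
  have dl2 := hl2.hasDerivAt_arc hg0 ht
  set l1 := arcDeriv g l with hl1_def
  set l2 := arcDeriv g l1 with hl2_def
  set l3 := arcDeriv g l2 with hl3_def
  have ep : ∀ v, arcDeriv g p t v = 4 / 3 * α * w t v * l t v
      + (1 - α) * f t v * l t v * (α / 3 * l1 t v + (1 - α / 3 - α ^ 2 / 3) * l t v ^ 2)
      + f t v * (α / 3 * l2 t v + 2 * (1 - α / 3 - α ^ 2 / 3) * l t v * l1 t v) := fun v =>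
    arcDeriv_eq_of_hasDerivAt hg0 ht
      ((((dw v).const_mul (-4 / 3)).add ((df v).mul (((dl1 v).const_mul (α / 3)).add
        (((dl v).pow 2).const_mul (1 - α / 3 - α ^ 2 / 3))))).congr_deriv
        (by simp; ring)) fun v => hp t ht v
  have eq1 : ∀ v, arcDeriv g q t v = -α * (4 * α / 3 - 1) * w t v * l t v
      - α ^ 2 / 3 * (1 - α) * f t v * l t v * (l1 t v + (2 - α) * l t v ^ 2)
      - α ^ 2 / 3 * f t v * (l2 t v + 2 * (2 - α) * l t v * l1 t v) := fun v =>
    arcDeriv_eq_of_hasDerivAt hg0 ht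
      ((((dw v).const_mul (4 * α / 3 - 1)).sub (((df v).const_mul (α ^ 2 / 3)).mul
        ((dl1 v).add (((dl v).pow 2).const_mul (2 - α))))).congr_deriv
        (by simp; ring)) fun v => hq t ht v
  have eq2 : arcDeriv g (arcDeriv g q) t u =
      -α * (4 * α / 3 - 1) * (-α * w t u * l t u ^ 2 + w t u * l1 t u)
      - α ^ 2 / 3 * (1 - α) * ((1 - α) * f t u * l t u ^ 2 * (l1 t u + (2 - α) * l t u ^ 2)
        + f t u * l1 t u * (l1 t u + (2 - α) * l t u ^ 2)
        + f t u * l t u * (l2 t u + 2 * (2 - α) * l t u * l1 t u))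
      - α ^ 2 / 3 * ((1 - α) * f t u * l t u * (l2 t u + 2 * (2 - α) * l t u * l1 t u)
        + f t u * (l3 t u + 2 * (2 - α) * (l1 t u ^ 2 + l t u * l2 t u))) :=
    arcDeriv_eq_of_hasDerivAt hg0 ht
      ((((((dw u).const_mul (-α * (4 * α / 3 - 1))).mul (dl u)).sub
        ((((df u).const_mul (α ^ 2 / 3 * (1 - α))).mul (dl u)).mul
          ((dl1 u).add (((dl u).pow 2).const_mul (2 - α))))).sub
        (((df u).const_mul (α ^ 2 / 3)).mul ((dl2 u).add
          (((dl u).const_mul (2 * (2 - α))).mul (dl1 u))))).congr_deriv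
        (by simp; ring)) fun v => eq1 v
  have el : ∀ v, timeDeriv l t v = 4 / 3 * α * (w t v * l t v)
      + (1 - α) * (f t v * l t v) * (α / 3 * l1 t v + (1 - α / 3 - α ^ 2 / 3) * l t v ^ 2)
      + f t v * (α / 3 * l2 t v + 2 * (1 - α / 3 - α ^ 2 / 3) * (l t v * l1 t v))
      - (-2 / 3 * w t v
        + f t v * ((3 - α) / 3 * l1 t v + (α ^ 2 - 2 * α + 3) / 3 * l t v ^ 2)) * l t v := by
    intro v
    rw [hlt t ht, ep, hh t ht]
    ring
  have eDl : arcDeriv g (timeDeriv l) t u = 4 / 3 * α * (-α * w t u * l t u ^ 2 + w t u * l1 t u)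
      + (1 - α) * ((1 - α) * f t u * l t u ^ 2 + f t u * l1 t u)
        * (α / 3 * l1 t u + (1 - α / 3 - α ^ 2 / 3) * l t u ^ 2)
      + (1 - α) * (f t u * l t u) * (α / 3 * l2 t u
        + (1 - α / 3 - α ^ 2 / 3) * (2 * l t u * l1 t u))
      + (1 - α) * f t u * l t u
        * (α / 3 * l2 t u + 2 * (1 - α / 3 - α ^ 2 / 3) * (l t u * l1 t u))
      + f t u * (α / 3 * l3 t u
        + 2 * (1 - α / 3 - α ^ 2 / 3) * (l1 t u ^ 2 + l t u * l2 t u))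
      - (2 / 3 * α * w t u * l t u
        + (1 - α) * f t u * l t u
          * ((3 - α) / 3 * l1 t u + (α ^ 2 - 2 * α + 3) / 3 * l t u ^ 2)
        + f t u * ((3 - α) / 3 * l2 t u
          + (α ^ 2 - 2 * α + 3) / 3 * (2 * l t u * l1 t u))) * l t u
      - (-2 / 3 * w t u
        + f t u * ((3 - α) / 3 * l1 t u + (α ^ 2 - 2 * α + 3) / 3 * l t u ^ 2)) * l1 t u :=
    arcDeriv_eq_of_hasDerivAt hg0 ht
      ((((((dw u).mul (dl u)).const_mul (4 / 3 * α)).add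
        ((((df u).mul (dl u)).const_mul (1 - α)).mul (((dl1 u).const_mul (α / 3)).add
          (((dl u).pow 2).const_mul (1 - α / 3 - α ^ 2 / 3))))).add
        ((df u).mul (((dl2 u).const_mul (α / 3)).add
          (((dl u).mul (dl1 u)).const_mul (2 * (1 - α / 3 - α ^ 2 / 3)))))).sub
        ((((dw u).const_mul (-2 / 3)).add ((df u).mul
          (((dl1 u).const_mul ((3 - α) / 3)).add
            (((dl u).pow 2).const_mul ((α ^ 2 - 2 * α + 3) / 3))))).mul (dl u))
        |>.congr_deriv (by simp; ring)) el
  have el1 : timeDeriv l1 t u = arcDeriv g (timeDeriv l) t u - h t u * l1 t u := by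
    rw [hl1_def, timeDeriv_arcDeriv hl hg hg0 ht, hgt t ht]
  have eqt := timeDeriv_eq_of_hasDerivAt ht
    (((hw.hasDerivAt_time ht u).const_mul (4 * α / 3 - 1)).sub
      (((hf.hasDerivAt_time ht u).const_mul (α ^ 2 / 3)).mul ((hl1.hasDerivAt_time ht u).add
        (((hl.hasDerivAt_time ht u).pow 2).const_mul (2 - α))))) fun τ hτ => hq τ hτ u
  rw [eqt, el1, eDl, hh t ht, el, hwt t ht, hft t ht, eq2, eq1, hp t ht, hq t ht]
  simp
  field_simp
  ring

end SmoothFamily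

/-! ### Maximum principle for ancient solutions -/

theorem Function.Periodic.deriv_real {E : Type*} [NormedAddCommGroup E] [NormedSpace ℝ E]
    {f : ℝ → E} {c : ℝ} (hf : Function.Periodic f c) : Function.Periodic (_root_.deriv f) c :=
  fun u => by rw [← deriv_comp_add_const, show (fun v => f (v + c)) = f from funext hf]

theorem Function.Periodic.arcDeriv {g F : ℝ → ℝ → ℝ} {t c : ℝ}
    (hg : Function.Periodic (g t) c) (hF : Function.Periodic (F t) c) :
    Function.Periodic (arcDeriv g F t) c := fun u => by
  simp only [_root_.arcDeriv, paramDeriv, hg u, hF.deriv_real u]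

namespace SmoothFamily

variable {T t c : ℝ} {q : ℝ → ℝ → ℝ}

/-- A maximum principle for ancient supersolutions. If `q` is periodic in `u` and satisfies
`∂_t q > q²` wherever its first spatial derivative vanishes and its second one is nonnegative,
then `q (t, u) > -1 / (t - t₀)`, in view of the solution `-1 / (t - t₀)` of the equation `y' = y²`
that comes from `-∞` at time `t₀`. As the starting time `t₀` is arbitrary, `q` is nonnegative. -/
theorem nonneg_of_ancient_supersolution (hq : SmoothFamily T q) (hc : 0 < c)
    (hper : ∀ t < T, Function.Periodic (q t) c)
    (hsuper : ∀ t < T, ∀ u, paramDeriv q t u = 0 → 0 ≤ paramDeriv (paramDeriv q) t u →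
      q t u ^ 2 < timeDeriv q t u) (ht : t < T) (u : ℝ) : 0 ≤ q t u := by
  have key : ∀ t₀ < t, 0 < (t - t₀) * q t u + 1 := by
    intro t₀ ht₀
    set Z : ℝ × ℝ → ℝ := fun r => (r.1 - t₀) * q r.1 r.2 + 1 with hZ
    have hZc : ContinuousOn Z (Set.Icc t₀ t ×ˢ Set.Icc 0 c) := by
      have h1 : ContinuousOn (fun r : ℝ × ℝ => q r.1 r.2) (Set.Icc t₀ t ×ˢ Set.Icc 0 c) :=
        (ContDiffOn.continuousOn hq).mono
          (Set.prod_mono (fun s hs => hs.2.trans_lt ht) (Set.subset_univ _))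
      fun_prop
    have hred : ∀ s < T, ∀ v, ∃ v' ∈ Set.Icc 0 c, Z (s, v) = Z (s, v') := by
      intro s hs v
      obtain ⟨v', hv', h⟩ := (hper s hs).exists_mem_Ico₀ hc v
      exact ⟨v', Set.Ico_subset_Icc_self hv', by simp only [hZ, h]⟩
    by_contra! hneg
    -- The first time at which `Z` fails to be positive.
    set S := (Set.Icc t₀ t ×ˢ Set.Icc 0 c) ∩ Z ⁻¹' Set.Iic 0 with hS
    have hScl : IsCompact S := (isCompact_Icc.prod isCompact_Icc).of_isClosed_subset
      (hZc.preimage_isClosed_of_isClosed (isClosed_Icc.prod isClosed_Icc) isClosed_Iic)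
      Set.inter_subset_left
    have hSne : S.Nonempty := by
      obtain ⟨u', hu', h⟩ := hred t ht u
      exact ⟨(t, u'), ⟨⟨ht₀.le, le_rfl⟩, hu'⟩, show Z (t, u') ≤ 0 from h ▸ hneg⟩
    obtain ⟨⟨s, v⟩, ⟨⟨⟨hs0, hs1⟩, hv⟩, hle⟩, hmin⟩ :=
      hScl.exists_isMinOn hSne continuous_fst.continuousOn
    simp only at hs0 hs1
    have hle' : Z (s, v) ≤ 0 := hle
    have hsT : s < T := hs1.trans_lt ht
    have hs : t₀ < s := by
      refine lt_of_le_of_ne hs0 fun h => ?_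
      simp [hZ, ← h] at hle'
      linarith
    have hbefore : ∀ r, t₀ ≤ r → r < s → ∀ v, 0 < Z (r, v) := by
      intro r hr hrs v
      by_contra! hn
      obtain ⟨v', hv', h⟩ := hred r (hrs.trans hsT) v
      have hmem : (r, v') ∈ S := ⟨⟨⟨hr, hrs.le.trans hs1⟩, hv'⟩, show Z (r, v') ≤ 0 from h ▸ hn⟩
      exact hrs.not_ge (hmin hmem)
    have hZt : ∀ v, HasDerivAt (fun τ => Z (τ, v)) (q s v + (s - t₀) * timeDeriv q s v) s :=
      fun v => by
        refine ((((hasDerivAt_id s).sub_const t₀).mul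
          (hq.hasDerivAt_time hsT v)).add_const 1).congr_deriv ?_
        simp
    have hev : ∀ᶠ r in nhdsWithin s (Set.Iio s), t₀ ≤ r ∧ r < s := by
      filter_upwards [Ioo_mem_nhdsLT hs] with r hr using ⟨hr.1.le, hr.2⟩
    have hge : ∀ v, 0 ≤ Z (s, v) := fun v =>
      ge_of_tendsto ((hZt v).continuousAt.continuousWithinAt (s := Set.Iio s))
        (hev.mono fun r hr => (hbefore r hr.1 hr.2 v).le)
    have hZ0 : Z (s, v) = 0 := le_antisymm hle' (hge v)
    have hst : 0 < s - t₀ := sub_pos.2 hs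
    have hloc : IsLocalMin (q s) v := Filter.Eventually.of_forall fun v' => by
      have := hge v'
      rw [← hZ0] at this
      simp only [hZ] at this
      exact le_of_mul_le_mul_left (by linarith) hst
    have h1 : paramDeriv q s v = 0 := hloc.deriv_eq_zero
    have h2 : 0 ≤ paramDeriv (paramDeriv q) s v := by
      have := IsLocalMax.second_deriv_nonpos (f := fun v => -q s v)
        (f' := fun v => -paramDeriv q s v) hloc.neg
        (fun v => (hq.hasDerivAt_param hsT v).neg) (hq.param.hasDerivAt_param hsT v).neg
      linarith
    have h3 := hsuper s hsT v h1 h2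
    have h4 : q s v + (s - t₀) * timeDeriv q s v ≤ 0 := by
      have hslope := (hasDerivAt_iff_tendsto_slope_left_right.1 (hZt v)).1
      refine le_of_tendsto hslope (hev.mono fun r hr => ?_)
      rw [slope_def_field]
      refine div_nonpos_of_nonneg_of_nonpos ?_ (by linarith [hr.2])
      simp only at *
      linarith [hbefore r hr.1 hr.2 v]
    have h5 : (s - t₀) * q s v = -1 := by
      simp only [hZ] at hZ0
      linarith
    have h6 := mul_lt_mul_of_pos_left h3 hst
    have h7 : (s - t₀) * q s v ^ 2 = -q s v := by rw [pow_two, ← mul_assoc, h5]; ring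
    linarith
  by_contra! hneg
  have h := key (t - (-q t u)⁻¹) (by have := inv_pos.2 (neg_pos.2 hneg); linarith)
  rw [sub_sub_cancel] at h
  have : (-q t u)⁻¹ * q t u = -1 := by
    have := hneg.ne
    field_simp
  linarith

end SmoothFamily

/-! ### The affine invariants along the flow -/

namespace IsAncientSolution

variable {p T t α : ℝ} {K : ℝ → ConvexBody Plane} {X : ℝ → ℝ → Plane}

theorem nonempty_interior (hX : IsAncientSolution p T K X) (ht : t < T) :
    (interior (K t : Set Plane)).Nonempty := ⟨0, hX.origin_mem t ht⟩

theorem smooth_coord (hX : IsAncientSolution p T K X) (i : Fin 2) :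
    SmoothFamily T fun t u => X t u i :=
  (EuclideanSpace.proj (𝕜 := ℝ) i).contDiff.comp_contDiffOn hX.smooth

theorem paramDeriv_coord (hX : IsAncientSolution p T K X) (ht : t < T) (u : ℝ) (i : Fin 2) :
    paramDeriv (fun t u => X t u i) t u = deriv (X t) u i :=
  (((hX.boundary t ht).hasDerivAt u).plane_coord i).deriv

theorem paramDeriv_paramDeriv_coord (hX : IsAncientSolution p T K X) (ht : t < T) (u : ℝ)
    (i : Fin 2) : paramDeriv (paramDeriv fun t u => X t u i) t u = iteratedDeriv 2 (X t) u i := by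
  rw [paramDeriv, show paramDeriv (fun t u => X t u i) t = fun u => deriv (X t) u i from
    funext fun u => hX.paramDeriv_coord ht u i]
  exact (((hX.boundary t ht).hasDerivAt_deriv u).plane_coord i).deriv

theorem smooth_affineDensity (hX : IsAncientSolution p T K X) :
    SmoothFamily T fun t => affineDensity (X t) := by
  have h := ((hX.smooth_coord 0).param.mul (hX.smooth_coord 1).param.param).sub
    ((hX.smooth_coord 1).param.mul (hX.smooth_coord 0).param.param)
  have h' : SmoothFamily T fun t u => bracket (deriv (X t) u) (iteratedDeriv 2 (X t) u) :=
    h.congr fun t ht u => by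
      simp only [hX.paramDeriv_coord ht, hX.paramDeriv_paramDeriv_coord ht, bracket]
  exact h'.rpow (fun t ht u => ((hX.boundary t ht).bracket_pos u).ne') _

theorem affineDensity_pow (hX : IsAncientSolution p T K X) (ht : t < T) (u : ℝ) :
    affineDensity (X t) u ^ 3 = bracket (deriv (X t) u) (iteratedDeriv 2 (X t) u) := by
  rw [affineDensity, ← Real.rpow_natCast, ← Real.rpow_mul ((hX.boundary t ht).bracket_pos u).le]
  norm_num

theorem periodic_affineDensity (hX : IsAncientSolution p T K X) (ht : t < T) :
    Function.Periodic (affineDensity (X t)) (2 * Real.pi) := fun u => by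
  have h := (hX.boundary t ht).periodic
  simp only [affineDensity, iteratedDeriv_succ, iteratedDeriv_zero, h.deriv_real u,
    h.deriv_real.deriv_real u]

theorem affineNormal_coord (hX : IsAncientSolution p T K X) (ht : t < T) (u : ℝ) (i : Fin 2) :
    affineNormal (X t) u i = arcDeriv (fun t => affineDensity (X t))
      (arcDeriv (fun t => affineDensity (X t)) fun t u => X t u i) t u := by
  have hg := hX.smooth_affineDensity
  have hg0 : ∀ t < T, ∀ u, 0 < affineDensity (X t) u :=
    fun t ht => (hX.boundary t ht).affineDensity_pos
  have hd : HasDerivAt (affineDeriv (X t) (X t)) (deriv (affineDeriv (X t) (X t)) u) u := by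
    have h1 := ((hg.hasDerivAt_param ht u).inv (hg0 t ht u).ne').smul
      ((hX.boundary t ht).hasDerivAt_deriv u)
    exact h1.differentiableAt.hasDerivAt
  have h2 := (hd.plane_coord i).deriv
  have h3 : (fun v => affineDeriv (X t) (X t) v i) =
      arcDeriv (fun t => affineDensity (X t)) (fun t u => X t u i) t := funext fun v => by
    simp [arcDeriv, hX.paramDeriv_coord ht, affineDeriv]
  rw [h3] at h2
  rw [arcDeriv, paramDeriv, h2]
  simp [affineNormal, affineDeriv]

theorem affineSupport_eq (hX : IsAncientSolution p T K X) (ht : t < T) (u : ℝ) :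
    affineSupport (K t) (X t) u =
      X t u 0 * arcDeriv (fun t => affineDensity (X t)) (fun t u => X t u 1) t u
      - X t u 1 * arcDeriv (fun t => affineDensity (X t)) (fun t u => X t u 0) t u := by
  rw [(hX.boundary t ht).affineSupport_eq (hX.nonempty_interior ht), arcDeriv, arcDeriv,
    hX.paramDeriv_coord ht, hX.paramDeriv_coord ht, bracket]
  ring

theorem smooth_affineSupport (hX : IsAncientSolution p T K X) :
    SmoothFamily T fun t => affineSupport (K t) (X t) := by
  have hg := hX.smooth_affineDensity
  have hg0 : ∀ t < T, ∀ u, 0 < affineDensity (X t) u :=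
    fun t ht => (hX.boundary t ht).affineDensity_pos
  exact (((hX.smooth_coord 0).mul ((hX.smooth_coord 1).arc hg hg0)).sub
    ((hX.smooth_coord 1).mul ((hX.smooth_coord 0).arc hg hg0))).congr
    fun t ht u => hX.affineSupport_eq ht u

theorem affineSupport_pos (hX : IsAncientSolution p T K X) (ht : t < T) (u : ℝ) :
    0 < affineSupport (K t) (X t) u :=
  (hX.boundary t ht).affineSupport_pos (hX.origin_mem t ht) u

theorem periodic_affineSupport (hX : IsAncientSolution p T K X) (ht : t < T) :
    Function.Periodic (affineSupport (K t) (X t)) (2 * Real.pi) := fun u => by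
  have hg := hX.periodic_affineDensity ht
  have hz : ∀ i : Fin 2, Function.Periodic (fun u => X t u i) (2 * Real.pi) := fun i u => by
    simp only [(hX.boundary t ht).periodic u]
  have hd := fun i => Function.Periodic.arcDeriv (g := fun t => affineDensity (X t))
    (F := fun t u => X t u i) hg (hz i)
  rw [hX.affineSupport_eq ht, hX.affineSupport_eq ht, hd 0 u, hd 1 u,
    (hX.boundary t ht).periodic u]

/-- Along the flow with exponent `α = 3p/(p+2)`, both the affine arc length density and `σ` evolve
by expressions in `w = σ ^ (-α)`, `f = σ ^ (1 - α)`, `l = σ_𝔰 / σ` and `l_𝔰`. -/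
theorem evolution (hX : IsAncientSolution p T K X) (hα : α = 3 * p / (p + 2))
    {g σ w f l : ℝ → ℝ → ℝ} (hg : g = fun t => affineDensity (X t))
    (hσ : σ = fun t => affineSupport (K t) (X t)) (hw : w = fun t u => σ t u ^ (-α))
    (hf : f = fun t u => σ t u ^ (1 - α)) (hl : l = fun t u => (σ t u)⁻¹ * arcDeriv g σ t u)
    (ht : t < T) (u : ℝ) :
    timeDeriv g t u / g t u = -2 / 3 * w t u
      + f t u * ((3 - α) * arcDeriv g l t u + (α ^ 2 - 2 * α + 3) * l t u ^ 2) / 3 ∧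
    timeDeriv σ t u = σ t u * (-4 / 3 * w t u
      + f t u * (α / 3 * arcDeriv g l t u + (1 - α / 3 - α ^ 2 / 3) * l t u ^ 2)) := by
  have hgs : SmoothFamily T g := hg ▸ hX.smooth_affineDensity
  have hσs : SmoothFamily T σ := hσ ▸ hX.smooth_affineSupport
  have hg0 : ∀ t < T, ∀ u, 0 < g t u := fun t ht u => hg ▸ (hX.boundary t ht).affineDensity_pos u
  have hσ0 : ∀ t < T, ∀ u, 0 < σ t u := fun t ht u => hσ ▸ hX.affineSupport_pos ht u
  have hfs : SmoothFamily T f := hf ▸ hσs.rpow (fun t ht u => (hσ0 t ht u).ne') _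
  have hls : SmoothFamily T l :=
    hl ▸ (hσs.inv fun t ht u => (hσ0 t ht u).ne').mul (hσs.arc hgs hg0)
  have hflow : ∀ i : Fin 2, ∀ t < T, ∀ u, timeDeriv (fun t u => X t u i) t u =
      f t u * arcDeriv g (arcDeriv g fun t u => X t u i) t u := by
    intro i t ht u
    have h := ((hX.flow t ht u).plane_coord i).deriv
    rw [timeDeriv, h, hg, ← hX.affineNormal_coord ht, hf, hσ, hα]
    simp
  obtain ⟨μ, hμ⟩ := SmoothFamily.evolution_of_normal_flow (σ := σ) (hX.smooth_coord 0)
    (hX.smooth_coord 1) hgs hfs hg0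
    (fun t ht u => by
      rw [hX.paramDeriv_paramDeriv_coord ht, hX.paramDeriv_paramDeriv_coord ht,
        hX.paramDeriv_coord ht, hX.paramDeriv_coord ht, hg]
      exact hX.affineDensity_pow ht u)
    (fun t ht u => by rw [hσ, hg]; exact hX.affineSupport_eq ht u) (hflow 0) (hflow 1)
  have h0 := hσ0 t ht u
  have e1 : ∀ v, arcDeriv g σ t v = σ t v * l t v := fun v => by
    have := (hσ0 t ht v).ne'
    rw [hl]
    field_simp
  have e2 : arcDeriv g (arcDeriv g σ) t u = σ t u * (l t u ^ 2 + arcDeriv g l t u) :=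
    SmoothFamily.arcDeriv_eq_of_hasDerivAt hg0 ht
      (((hσs.hasDerivAt_arc hg0 ht u).mul (hls.hasDerivAt_arc hg0 ht u)).congr_deriv
        (by rw [e1 u]; ring)) e1
  have f1 : ∀ v, arcDeriv g f t v = (1 - α) * (f t v * l t v) := fun v => by
    rw [hf, hσs.arcDeriv_rpow hσ0 hg0 _ ht, hl]
    ring
  have f2 : arcDeriv g (arcDeriv g f) t u =
      (1 - α) * (f t u * ((1 - α) * l t u ^ 2 + arcDeriv g l t u)) :=
    SmoothFamily.arcDeriv_eq_of_hasDerivAt hg0 ht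
      ((((hfs.hasDerivAt_arc hg0 ht u).mul (hls.hasDerivAt_arc hg0 ht u)).const_mul
        (1 - α)).congr_deriv (by rw [f1 u]; ring)) f1
  have hfw : f t u = σ t u * w t u := by
    rw [hf, hw]
    simp only
    rw [sub_eq_add_neg, Real.rpow_add h0, Real.rpow_one]
  obtain ⟨m1, m2, m3⟩ := hμ t ht u
  rw [e2] at m1
  rw [f2] at m2
  rw [f1, e1] at m3
  have hfμ : f t u * μ t u = w t u - f t u * (l t u ^ 2 + arcDeriv g l t u) := by
    rw [hfw]
    linear_combination w t u * m1
  have hgt : timeDeriv g t u / g t u = -2 / 3 * w t u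
      + f t u * ((3 - α) * arcDeriv g l t u + (α ^ 2 - 2 * α + 3) * l t u ^ 2) / 3 := by
    linear_combination (1 / 3) * m2 - (2 / 3) * hfμ
  refine ⟨hgt, ?_⟩
  rw [m3, hgt, hfμ]
  linear_combination -hfw

/-- The Harnack inequality for ancient solutions, in affine arc length. -/
theorem harnack (hX : IsAncientSolution p T K X) (hα : α = 3 * p / (p + 2)) (hα1 : 1 < α)
    {g σ w f l : ℝ → ℝ → ℝ} (hg : g = fun t => affineDensity (X t))
    (hσ : σ = fun t => affineSupport (K t) (X t)) (hw : w = fun t u => σ t u ^ (-α))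
    (hf : f = fun t u => σ t u ^ (1 - α)) (hl : l = fun t u => (σ t u)⁻¹ * arcDeriv g σ t u)
    (ht : t < T) (u : ℝ) :
    0 ≤ (4 * α / 3 - 1) * w t u
      - α ^ 2 / 3 * f t u * (arcDeriv g l t u + (2 - α) * l t u ^ 2) := by
  have hev := fun t (ht : t < T) u => hX.evolution hα hg hσ hw hf hl ht u
  have hgs : SmoothFamily T g := hg ▸ hX.smooth_affineDensity
  have hσs : SmoothFamily T σ := hσ ▸ hX.smooth_affineSupport
  have hg0 : ∀ t < T, ∀ u, 0 < g t u := fun t ht u => hg ▸ (hX.boundary t ht).affineDensity_pos u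
  have hσ0 : ∀ t < T, ∀ u, 0 < σ t u := fun t ht u => hσ ▸ hX.affineSupport_pos ht u
  have hσ1 : ∀ t < T, ∀ u, σ t u ≠ 0 := fun t ht u => (hσ0 t ht u).ne'
  have hfs : SmoothFamily T f := hf ▸ hσs.rpow hσ1 _
  have hws : SmoothFamily T w := hw ▸ hσs.rpow hσ1 _
  have hls : SmoothFamily T l := hl ▸ (hσs.inv hσ1).mul (hσs.arc hgs hg0)
  have hper : ∀ t < T, Function.Periodic (g t) (2 * Real.pi) ∧
      Function.Periodic (σ t) (2 * Real.pi) := fun t ht =>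
    ⟨hg ▸ hX.periodic_affineDensity ht, hσ ▸ hX.periodic_affineSupport ht⟩
  have hlper : ∀ t < T, Function.Periodic (l t) (2 * Real.pi) := fun t ht u => by
    rw [hl]
    simp only [(hper t ht).2 u, (hper t ht).1.arcDeriv (hper t ht).2 u]
  set P : ℝ → ℝ → ℝ := fun t u => -4 / 3 * w t u
      + f t u * (α / 3 * arcDeriv g l t u + (1 - α / 3 - α ^ 2 / 3) * l t u ^ 2) with hP
  set q : ℝ → ℝ → ℝ := fun t u => (4 * α / 3 - 1) * w t u
      - α ^ 2 / 3 * f t u * (arcDeriv g l t u + (2 - α) * l t u ^ 2) with hq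
  have hqs : SmoothFamily T q := ((SmoothFamily.const _).mul hws).sub
    (((SmoothFamily.const _).mul hfs).mul ((hls.arc hgs hg0).add
      ((SmoothFamily.const _).mul (hls.pow 2))))
  have hlog : ∀ t < T, ∀ u, (σ t u)⁻¹ * timeDeriv σ t u = P t u := fun t ht u => by
    rw [(hev t ht u).2, inv_mul_cancel_left₀ (hσ1 t ht u)]
  -- `l = (log σ)_𝔰` evolves by the commutator rule, because `∂_t log σ = P`.
  have hlt : ∀ t < T, ∀ u, timeDeriv l t u =
      arcDeriv g P t u - timeDeriv g t u / g t u * l t u := by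
    intro t ht u
    have h0 := hσ1 t ht u
    have d1 := SmoothFamily.timeDeriv_eq_of_hasDerivAt (F := l) ht
      (((hσs.hasDerivAt_time ht u).inv h0).mul ((hσs.arc hgs hg0).hasDerivAt_time ht u))
      fun τ _ => by rw [hl]; rfl
    have d2 := SmoothFamily.arcDeriv_eq_of_hasDerivAt (F := P) (u := u) hg0 ht
      ((((hσs.hasDerivAt_arc hg0 ht u).inv h0).mul
        (hσs.time.hasDerivAt_arc hg0 ht u)).congr_deriv
        (by simp only [Pi.inv_apply]; ring : _ = g t u * (-arcDeriv g σ t u / σ t u ^ 2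
          * timeDeriv σ t u + (σ t u)⁻¹ * arcDeriv g (timeDeriv σ) t u)))
      fun v => (hlog t ht v).symm
    rw [d1, d2, SmoothFamily.timeDeriv_arcDeriv hσs hgs hg0 ht, hl]
    simp only [Pi.inv_apply]
    ring
  have hqt := fun t (ht : t < T) u => SmoothFamily.evolution_of_harnack (α := α) (by linarith)
    hgs hws hfs hls hg0 (p := P) (h := fun t u => timeDeriv g t u / g t u) (q := q)
    (fun _ _ _ => rfl) (fun t ht u => (hev t ht u).1) (fun _ _ _ => rfl)
    (fun t ht u => by rw [hw, hσs.arcDeriv_rpow hσ0 hg0 _ ht, hl])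
    (fun t ht u => by rw [hf, hσs.arcDeriv_rpow hσ0 hg0 _ ht, hl])
    (fun t ht u => by rw [← hlog t ht u, hw, hσs.timeDeriv_rpow hσ0 _ ht])
    (fun t ht u => by rw [← hlog t ht u, hf, hσs.timeDeriv_rpow hσ0 _ ht])
    hlt (fun _ _ _ => rfl) ht u
  refine hqs.nonneg_of_ancient_supersolution (c := 2 * Real.pi) (by positivity) ?_ ?_ ht u
  · intro t ht u
    simp only [hq, hw, hf, (hper t ht).2 u, hlper t ht u,
      (hper t ht).1.arcDeriv (hlper t ht) u]
  · intro t ht u h1 h2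
    have hD : arcDeriv g q t u = 0 := by rw [arcDeriv, h1, mul_zero]
    have hD2 : 0 ≤ arcDeriv g (arcDeriv g q) t u := by
      have h := (((hgs.hasDerivAt_param ht u).inv (hg0 t ht u).ne').mul
        (hqs.param.hasDerivAt_param ht u)).deriv
      rw [arcDeriv]
      refine mul_nonneg (inv_nonneg.2 (hg0 t ht u).le) ?_
      refine le_of_le_of_eq ?_ h.symm
      rw [h1, mul_zero, zero_add]
      exact mul_nonneg (inv_nonneg.2 (hg0 t ht u).le) h2
    have hw0 : 0 < w t u := by rw [hw]; exact Real.rpow_pos_of_pos (hσ0 t ht u) _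
    have hf0 : 0 < f t u := by rw [hf]; exact Real.rpow_pos_of_pos (hσ0 t ht u) _
    rw [hqt t ht u, hD]
    have a1 : 0 ≤ α / 3 * f t u * arcDeriv g (arcDeriv g q) t u := by positivity
    have a2 : 0 < (α - 1) * w t u ^ 2 := mul_pos (by linarith) (by positivity)
    have a3 : 0 ≤ 3 / α * (q t u - (α - 1) * w t u) ^ 2 := by positivity
    linarith

end IsAncientSolution

theorem mainTheorem4 (p T : ℝ) (hp : 1 < p) (K : ℝ → ConvexBody Plane) (X : ℝ → ℝ → Plane)
    (hX : IsAncientSolution p T K X) (t : ℝ) (ht : t < T) (u : ℝ) :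
    0 < affineSupport (K t) (X t) u ∧
    DifferentiableAt ℝ (affineSupport (K t) (X t)) u ∧
    DifferentiableAt ℝ (fun τ => affineSupport (K τ) (X τ) u) t ∧
    deriv (fun τ => affineSupport (K τ) (X τ) u) t ≤
      -(3 * p / (p + 2) - 1) * affineDeriv (X t) (affineSupport (K t) (X t)) u ^ 2
        * affineSupport (K t) (X t) u ^ (-(3 * p / (p + 2))) := by
  have hs := hX.smooth_affineSupport
  have h0 := hX.affineSupport_pos ht u
  refine ⟨h0, (hs.hasDerivAt_param ht u).differentiableAt,
    (hs.hasDerivAt_time ht u).differentiableAt, ?_⟩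
  generalize hα : 3 * p / (p + 2) = α
  have hα1 : 1 < α := by rw [← hα, lt_div_iff₀ (by linarith)]; linarith
  have hq := hX.harnack hα.symm hα1 rfl rfl rfl rfl rfl ht u
  have hσt := (hX.evolution hα.symm rfl rfl rfl rfl rfl ht u).2
  have hD : arcDeriv (fun t => affineDensity (X t)) (fun t => affineSupport (K t) (X t)) t u =
      affineDeriv (X t) (affineSupport (K t) (X t)) u := rfl
  change timeDeriv (fun t => affineSupport (K t) (X t)) t u ≤ _
  simp only [hD] at hq hσt
  rw [hσt]
  clear hD hσt
  generalize arcDeriv _ _ t u = l₁ at *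
  generalize affineDeriv (X t) (affineSupport (K t) (X t)) u = σ₁ at *
  generalize affineSupport (K t) (X t) u = σ at *
  have hf : σ ^ (1 - α) = σ * σ ^ (-α) := by
    rw [sub_eq_add_neg, Real.rpow_add h0, Real.rpow_one]
  have hw : 0 < σ ^ (-α) := Real.rpow_pos_of_pos h0 _
  rw [hf] at hq ⊢
  generalize σ ^ (-α) = w at *
  -- The two sides differ by `-σ (q + w) / α`, where `q` is the Harnack quantity.
  rw [← sub_nonneg]
  have hpos : 0 ≤ σ / α * (((4 * α / 3 - 1) * w
      - α ^ 2 / 3 * (σ * w) * (l₁ + (2 - α) * (σ⁻¹ * σ₁) ^ 2)) + w) :=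
    mul_nonneg (by positivity) (by linarith)
  refine hpos.trans_eq ?_
  have : α ≠ 0 := by linarith
  field_simp
  ring
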